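/- A scheme is called coherent if it is quasicompact and quasiseparated. A morphism of schemes is a universal homeomorphism if each of its base changes is a homeomorphism on underlying topological spaces. A coherent scheme $Y$ is called topologically rigid if every universal homeomorphism $Y'\to Y$ with $Y'$ reduced is an isomorphism. For a coherent scheme $X$, let $(\mathrm{Sch}_{\mathrm{coh}}/X)$ be the category of coherent $X$-schemes, let $(\mathrm{Sch}_{\mathrm{trig}}/X)$ be its full subcategory spanned by the topologically rigid $X$-schemes, and let $j\colon(\mathrm{Sch}_{\mathrm{trig}}/X)\hookrightarrow(\mathrm{Sch}_{\mathrm{coh}}/X)$ be the inclusion. Proposition. Let $X$ be a coherent scheme, let $\Lambda$ be a small filtered category, and let $Z_\ast\colon\Lambda^{\mathrm{op}}\to(\mathrm{Sch}_{\mathrm{trig}}/X)$ be a diagram such that each structure morphism $Z_\alpha\to X$ is affine. Then $j$ reflects the limit of $Z_\ast$, in the following strong sense. If a cone with vertex $Z$ is a limit cone over $j\circ Z_\ast$ in $(\mathrm{Sch}_{\mathrm{coh}}/X)$, then $Z$ is topologically rigid, and the cone is, up to isomorphism of cones, the image under $j$ of a limit cone over $Z_\ast$ in $(\mathrm{Sch}_{\mathrm{trig}}/X)$.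 Moreover, any cone over $Z_\ast$ in $(\mathrm{Sch}_{\mathrm{trig}}/X)$ whose image under $j$ is a limit cone is itself a limit cone. -/

import Mathlib

open CategoryTheory CategoryTheory.Limits AlgebraicGeometry

universe u

namespace TopRigid

/-- A morphism of schemes is a universal homeomorphism if each of its base changes is a
homeomorphism on the underlying topological spaces. -/
def UniversalHomeomorphism {Y' Y : Scheme.{u}} (f : Y' ⟶ Y) : Prop :=
  MorphismProperty.universally (topologically (IsHomeomorph ·)) f

/-- A scheme is coherent if it is quasicompact and quasiseparated. -/
structure IsCoherent (Y : Scheme.{u}) : Prop where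
  compactSpace : CompactSpace Y
  quasiSeparatedSpace : QuasiSeparatedSpace Y

/-- A coherent scheme `Y` is topologically rigid if every universal homeomorphism to `Y` from a
reduced scheme is an isomorphism. -/
structure IsTopologicallyRigid (Y : Scheme.{u}) : Prop where
  isCoherent : IsCoherent Y
  isIso_of_universalHomeomorphism : ∀ (Y' : Scheme.{u}) (f : Y' ⟶ Y),
    IsReduced Y' → UniversalHomeomorphism f → IsIso f

/-- The category of coherent `X`-schemes. -/
abbrev SchCoh (X : Scheme.{u}) :=
  ObjectProperty.FullSubcategory (fun Y : Over X => IsCoherent Y.left)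

/-- The full subcategory of coherent `X`-schemes spanned by the topologically rigid ones. -/
abbrev SchTrig (X : Scheme.{u}) :=
  ObjectProperty.FullSubcategory (fun Y : SchCoh X => IsTopologicallyRigid Y.obj.left)

/-- The inclusion of topologically rigid `X`-schemes into coherent `X`-schemes. -/
abbrev trigInclusion (X : Scheme.{u}) : SchTrig X ⥤ SchCoh X :=
  ObjectProperty.ι (fun Y : SchCoh X => IsTopologicallyRigid Y.obj.left)

end TopRigid

/-! Topological rigidity of a coherent scheme is an algebraic condition on rings of sections. Call a
ring absolutely weakly normal if it is reduced, every solution of `x ^ 3 = y ^ 2` has the form `(a ^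
2, a ^ 3)`, and for every prime `p` every solution of `p ^ p * x = y ^ p` has the form `(a ^ p, p *
a)`.

Rigid implies weakly normal (`IsTopologicallyRigid.isAbsWeaklyNormal`): adjoin to the sections all
missing `a`, realised as functions into algebraic closures of residue fields. The result glues to a
reduced scheme universally homeomorphic to `Y`, so rigidity says nothing was missing.

Conversely (`isTopologicallyRigid_of_isAbsWeaklyNormal`), a universal homeomorphism is integral,
universally injective and surjective. Over a weakly normal ring, a reduced ring of this kind is the
base itself, by a conductor argument (`algebraMap_surjective_of_finite`).

The conditions involve finitely many elements and equations at a time, so they survive filtered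
colimits of rings. Over an affine open of `X` the limit is the spectrum of such a colimit, so it is
rigid. The rest is formal, the inclusion being fully faithful. -/

namespace TopRigid

/-! ### Integral radicial extensions of absolutely weakly normal rings -/

section Ring

variable {A B : Type*} [CommRing A] [CommRing B] [Algebra A B]

/-- The elements of `B` all of whose multiples come from `A`, as an ideal of `B`. -/
def imageConductor (A B : Type*) [CommRing A] [CommRing B] [Algebra A B] : Ideal B where
  carrier := {x | ∀ b, x * b ∈ (algebraMap A B).range}
  add_mem' hx hy b := by rw [add_mul]; exact add_mem (hx b) (hy b)
  zero_mem' b := by rw [zero_mul]; exact zero_mem _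
  smul_mem' c x hx b := by
    rw [smul_eq_mul, mul_comm c x, mul_assoc]; exact hx _

lemma mem_imageConductor {x : B} :
    x ∈ imageConductor A B ↔ ∀ b, x * b ∈ (algebraMap A B).range := Iff.rfl

/-- If `x ^ 2` is in the conductor, the square and the cube of any `x * b` come from `A`, hence so
does `x * b`. -/
lemma imageConductor_isRadical
    (hcusp : ∀ b : B, b ^ 2 ∈ (algebraMap A B).range → b ^ 3 ∈ (algebraMap A B).range →
      b ∈ (algebraMap A B).range) :
    (imageConductor A B).IsRadical := by
  rw [Ideal.isRadical_iff_quotient_reduced, isReduced_iff_pow_one_lt 2 (by norm_num)]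
  intro x hx
  obtain ⟨x, rfl⟩ := Ideal.Quotient.mk_surjective x
  rw [← map_pow, Ideal.Quotient.eq_zero_iff_mem] at hx
  rw [Ideal.Quotient.eq_zero_iff_mem]
  intro b
  refine hcusp _ ?_ ?_
  · rw [mul_pow]; exact hx _
  · rw [show (x * b) ^ 3 = x ^ 2 * (x * b ^ 3) by ring]; exact hx _

/-- A form of "universally injective" for a ring map that only mentions elements and primes. -/
structure IsRadicial (A B : Type*) [CommRing A] [CommRing B] [Algebra A B] : Prop where
  eq_of_comap_eq : ∀ P Q : Ideal B, P.IsPrime → Q.IsPrime →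
    P.comap (algebraMap A B) = Q.comap (algebraMap A B) → P = Q
  exists_pow_sub_mem : ∀ Q : Ideal B, Q.IsPrime → ∀ b : B, ∃ (s a : A) (p n : ℕ),
    algebraMap A B s ∉ Q ∧ (p = 1 ∨ p.Prime ∧ (p : B) ∈ Q) ∧
      algebraMap A B s * b ^ p ^ n - algebraMap A B a ∈ Q

/-- After inverting the complement of `q`, minimality of `q` and radiciality leave `Q` as the only
prime containing the conductor. So `y` is nilpotent modulo the conductor there, hence zero, the
conductor being radical. -/
lemma exists_mul_mem_imageConductor [Algebra.IsIntegral A B] (hrad : IsRadicial A B)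
    (hJ : (imageConductor A B).IsRadical)
    {q : Ideal A} (hq : q ∈ ((imageConductor A B).comap (algebraMap A B)).minimalPrimes)
    {Q : Ideal B} [Q.IsPrime] (hQ : Q.comap (algebraMap A B) = q) {y : B} (hy : y ∈ Q) :
    ∃ s ∉ q, algebraMap A B s * y ∈ imageConductor A B := by
  have hqp : q.IsPrime := hq.1.1
  have key : ¬ Disjoint (imageConductor A B : Set B)
      ((q.primeCompl.map (algebraMap A B) ⊔ Submonoid.powers y : Submonoid B) : Set B) := by
    intro hdis
    obtain ⟨Q', hQ', hle, hdis'⟩ := Ideal.exists_le_prime_disjoint _ _ hdis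
    have hle' : Q'.comap (algebraMap A B) ≤ q := by
      intro a ha
      by_contra haq
      exact Set.disjoint_left.mp hdis' ha
        (Submonoid.mem_sup_left (Submonoid.mem_map_of_mem _ haq))
    have heq : Q'.comap (algebraMap A B) = q :=
      le_antisymm hle' (hq.2 ⟨hQ'.comap _, Ideal.comap_mono hle⟩ hle')
    have : Q' = Q := hrad.eq_of_comap_eq _ _ hQ' ‹_› (heq.trans hQ.symm)
    subst this
    exact Set.disjoint_left.mp hdis' hy (Submonoid.mem_sup_right (Submonoid.mem_powers y))
  obtain ⟨z, hz, hz'⟩ := Set.not_disjoint_iff.mp key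
  obtain ⟨_, ⟨s, hs, rfl⟩, _, ⟨m, rfl⟩, rfl⟩ := Submonoid.mem_sup.mp hz'
  refine ⟨s, hs, hJ ⟨m + 1, ?_⟩⟩
  have : (algebraMap A B s * y) ^ (m + 1) =
      (algebraMap A B s ^ m * y) * (algebraMap A B s * y ^ m) := by ring
  rw [this]
  exact Ideal.mul_mem_left _ _ hz

/-- Radiciality puts some `s * b ^ p ^ n - a` in `Q`, and the previous lemma moves it into the
conductor. The exponent `p ^ n` is then removed one factor `p` at a time by `hfrob`. -/
lemma exists_mul_mem_range [Algebra.IsIntegral A B] (hrad : IsRadicial A B)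
    (hJ : (imageConductor A B).IsRadical)
    (hfrob : ∀ p : ℕ, p.Prime → ∀ b : B, (p : B) * b ∈ (algebraMap A B).range →
      b ^ p ∈ (algebraMap A B).range → b ∈ (algebraMap A B).range)
    {q : Ideal A} (hq : q ∈ ((imageConductor A B).comap (algebraMap A B)).minimalPrimes) (b : B) :
    ∃ s ∉ q, algebraMap A B s * b ∈ (algebraMap A B).range := by
  have hqp : q.IsPrime := hq.1.1
  obtain ⟨Q, -, hQp, hQ⟩ := Ideal.exists_ideal_over_prime_of_isIntegral q (imageConductor A B) hq.1.2
  obtain ⟨s, a, p, n, hs, hp, hmem⟩ := hrad.exists_pow_sub_mem Q hQp b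
  have hsq : s ∉ q := fun h => hs (by rw [← hQ] at h; exact h)
  obtain ⟨t, ht, htJ⟩ := exists_mul_mem_imageConductor hrad hJ hq hQ hmem
  have h1 : algebraMap A B (t * s) * b ^ p ^ n ∈ (algebraMap A B).range := by
    have := add_mem (htJ 1) (⟨t * a, rfl⟩ : algebraMap A B (t * a) ∈ (algebraMap A B).range)
    convert this using 1
    simp only [map_mul]; ring
  have hts : t * s ∉ q := fun h => (hqp.mem_or_mem h).elim ht hsq
  rcases hp with rfl | ⟨hp, hpQ⟩
  · exact ⟨t * s, hts, by simpa using h1⟩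
  -- The factor `r` puts `r * p` in the conductor, which supplies the hypothesis of `hfrob` on
  -- `p`-multiples at every stage of the descent.
  obtain ⟨r, hr, hrJ⟩ := exists_mul_mem_imageConductor hrad hJ hq hQ hpQ
  refine ⟨r * (t * s), fun h => (hqp.mem_or_mem h).elim hr hts, ?_⟩
  set c := algebraMap A B (r * (t * s)) * b with hc
  have hcn : ∀ m, m ≤ n → c ^ p ^ (n - m) ∈ (algebraMap A B).range := by
    intro m
    induction m with
    | zero =>
      intro _
      have hpos : p ^ n ≠ 0 := pow_ne_zero _ hp.ne_zero
      obtain ⟨k, hk⟩ := Nat.exists_eq_succ_of_ne_zero hpos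
      have : c ^ p ^ n = algebraMap A B (r ^ p ^ n * (t * s) ^ k) *
          (algebraMap A B (t * s) * b ^ p ^ n) := by
        rw [hc, mul_pow, ← map_pow, mul_pow, hk, Nat.succ_eq_add_one, pow_succ (t * s)]
        simp only [map_mul]; ring
      rw [Nat.sub_zero, this]
      exact mul_mem ⟨_, rfl⟩ h1
    | succ m ih =>
      intro hm
      refine hfrob p hp _ ?_ ?_
      · obtain ⟨k, hk⟩ := Nat.exists_eq_succ_of_ne_zero
          (pow_ne_zero (n - (m + 1)) hp.ne_zero)
        have : (p : B) * c ^ p ^ (n - (m + 1)) =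
            (algebraMap A B r * p) * (algebraMap A B (t * s) * b * c ^ k) := by
          rw [hk, Nat.succ_eq_add_one, pow_succ, hc]
          simp only [map_mul]; ring
        rw [this]
        exact hrJ _
      · rw [← pow_mul, ← pow_succ, show n - (m + 1) + 1 = n - m by omega]
        exact ih (by omega)
  simpa using hcn n le_rfl

/-- If the conductor were proper, take `q` minimal over its contraction. The product of the
multipliers of finitely many module generators lies in the conductor but not in `q`, a
contradiction. -/
lemma algebraMap_surjective_of_finite [Module.Finite A B] (hrad : IsRadicial A B)
    (hcusp : ∀ b : B, b ^ 2 ∈ (algebraMap A B).range → b ^ 3 ∈ (algebraMap A B).range →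
      b ∈ (algebraMap A B).range)
    (hfrob : ∀ p : ℕ, p.Prime → ∀ b : B, (p : B) * b ∈ (algebraMap A B).range →
      b ^ p ∈ (algebraMap A B).range → b ∈ (algebraMap A B).range) :
    Function.Surjective (algebraMap A B) := by
  classical
  have hJ := imageConductor_isRadical hcusp
  suffices h : (imageConductor A B).comap (algebraMap A B) = ⊤ by
    intro b
    have : (1 : A) ∈ (imageConductor A B).comap (algebraMap A B) := by rw [h]; trivial
    simpa using mem_imageConductor.mp this b
  by_contra hne
  obtain ⟨q, hq⟩ := Ideal.nonempty_minimalPrimes hne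
  have hqp : q.IsPrime := hq.1.1
  choose s hs hsR using exists_mul_mem_range hrad hJ hfrob hq
  obtain ⟨S, hS⟩ := Module.Finite.fg_top (R := A) (M := B)
  have hprod : ∏ b ∈ S, s b ∉ q := fun h => by
    obtain ⟨b, -, hb⟩ := (hqp.prod_mem_iff).mp h
    exact hs b hb
  refine hprod (hq.1.2 (fun b => ?_))
  have hb : b ∈ Submodule.span A (S : Set B) := by rw [hS]; trivial
  induction hb using Submodule.span_induction with
  | mem b hb =>
    rw [← Finset.prod_erase_mul _ _ hb, map_mul, mul_assoc]
    exact mul_mem ⟨_, rfl⟩ (hsR b)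
  | zero => rw [mul_zero]; exact zero_mem _
  | add x y _ _ hx hy => rw [mul_add]; exact add_mem hx hy
  | smul a x _ hx =>
    rw [Algebra.smul_def, mul_left_comm]
    exact mul_mem ⟨_, rfl⟩ hx

/-- By lying over, every prime of `C` is contracted from `B`, where radiciality is known. -/
lemma IsRadicial.subalgebra [Algebra.IsIntegral A B] (hrad : IsRadicial A B)
    (C : Subalgebra A B) : IsRadicial A C := by
  have hint : Algebra.IsIntegral C B := Algebra.IsIntegral.tower_top A
  have lift (P : Ideal C) (hP : P.IsPrime) :
      ∃ P' : Ideal B, P'.IsPrime ∧ P'.comap (algebraMap C B) = P := by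
    obtain ⟨Q, -, h, h'⟩ := Ideal.exists_ideal_over_prime_of_isIntegral P (⊥ : Ideal B) (by
      intro x hx
      have : x = 0 := Subtype.ext (by simpa using hx)
      simp [this])
    exact ⟨Q, h, h'⟩
  constructor
  · intro P Q hP hQ h
    obtain ⟨P', hP', rfl⟩ := lift P hP
    obtain ⟨Q', hQ', rfl⟩ := lift Q hQ
    rw [Ideal.comap_comap, Ideal.comap_comap] at h
    rw [hrad.eq_of_comap_eq P' Q' hP' hQ' h]
  · intro Q hQ b
    obtain ⟨Q', hQ', rfl⟩ := lift Q hQ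
    obtain ⟨s, a, p, n, hs, hp, hmem⟩ := hrad.exists_pow_sub_mem Q' hQ' b
    refine ⟨s, a, p, n, hs, hp.imp_right fun h => ⟨h.1, ?_⟩, ?_⟩
    · simpa using h.2
    · simpa using hmem

/-- The absolutely weakly normal rings. -/
structure IsAbsWeaklyNormal (A : Type*) [CommRing A] : Prop where
  isReduced : IsReduced A
  exists_sq_cube : ∀ x y : A, x ^ 3 = y ^ 2 → ∃ a, a ^ 2 = x ∧ a ^ 3 = y
  exists_pow_mul : ∀ p : ℕ, p.Prime → ∀ x y : A, (p : A) ^ p * x = y ^ p →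
    ∃ a, a ^ p = x ∧ p * a = y

lemma eq_of_sq_eq_of_cube_eq [IsReduced B] {a b : B} (h2 : a ^ 2 = b ^ 2) (h3 : a ^ 3 = b ^ 3) :
    a = b := by
  rw [← sub_eq_zero]
  refine eq_zero_of_pow_eq_zero (n := 3) ?_
  -- This is the expansion of `(a - b) ^ 3` in terms of `a ^ 2 - b ^ 2` and `a ^ 3 - b ^ 3`.
  linear_combination (-3 * a - 3 * b) * h2 + 4 * h3

/-- Since `p * (a - b) = 0`, the mixed terms of `((a - b) + b) ^ p` vanish, so `a - b` is nilpotent.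
-/
lemma eq_of_pow_eq_of_mul_eq [IsReduced B] {p : ℕ} (hp : p.Prime) {a b : B} (h : a ^ p = b ^ p)
    (h' : (p : B) * a = p * b) : a = b := by
  rw [← sub_eq_zero]
  have hpd : (p : B) * (a - b) = 0 := by rw [mul_sub, h', sub_self]
  refine eq_zero_of_pow_eq_zero (n := p + 1) ?_
  obtain ⟨r, hr⟩ := exists_add_pow_prime_eq hp (a - b) b
  rw [sub_add_cancel, h] at hr
  have h0 : (a - b) ^ p + p * (a - b) * b * r = 0 := by linear_combination -hr
  rw [hpd, zero_mul, zero_mul, add_zero] at h0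
  rw [pow_succ, h0, zero_mul]

lemma IsAbsWeaklyNormal.surjective_algebraMap (hA : IsAbsWeaklyNormal A) [IsReduced B]
    [Algebra.IsIntegral A B] (hinj : Function.Injective (algebraMap A B))
    (hrad : IsRadicial A B) : Function.Surjective (algebraMap A B) := by
  intro b
  -- The conductor argument needs a finite extension, and one generator suffices to catch `b`.
  let C := Algebra.adjoin A {b}
  have hfin : Module.Finite A C :=
    Algebra.finite_adjoin_simple_of_isIntegral (Algebra.IsIntegral.isIntegral b)
  have hCred : IsReduced C := isReduced_of_injective C.val Subtype.val_injective
  have hinj' : Function.Injective (algebraMap A C) := by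
    refine Function.Injective.of_comp (f := algebraMap C B) ?_
    rw [← RingHom.coe_comp, ← IsScalarTower.algebraMap_eq]
    exact hinj
  have hcusp : ∀ c : C, c ^ 2 ∈ (algebraMap A C).range → c ^ 3 ∈ (algebraMap A C).range →
      c ∈ (algebraMap A C).range := by
    rintro c ⟨x, hx⟩ ⟨y, hy⟩
    obtain ⟨a, h2, h3⟩ := hA.exists_sq_cube x y (hinj' (by
      rw [map_pow, map_pow, hx, hy]; ring))
    exact ⟨a, eq_of_sq_eq_of_cube_eq (by rw [← hx, ← map_pow, h2])
      (by rw [← hy, ← map_pow, h3])⟩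
  have hfrob : ∀ p : ℕ, p.Prime → ∀ c : C, (p : C) * c ∈ (algebraMap A C).range →
      c ^ p ∈ (algebraMap A C).range → c ∈ (algebraMap A C).range := by
    rintro p hp c ⟨y, hy⟩ ⟨x, hx⟩
    obtain ⟨a, h2, h3⟩ := hA.exists_pow_mul p hp x y (hinj' (by
      rw [map_mul, map_pow, map_pow, hx, hy, map_natCast]; ring))
    exact ⟨a, eq_of_pow_eq_of_mul_eq hp (by rw [← hx, ← map_pow, h2])
      (by rw [← hy, ← h3, map_mul, map_natCast])⟩
  obtain ⟨a, ha⟩ := algebraMap_surjective_of_finite (hrad.subalgebra C) hcusp hfrob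
    ⟨b, Algebra.self_mem_adjoin_singleton A b⟩
  exact ⟨a, congrArg Subtype.val ha⟩

end Ring

/-- Uniqueness of field-valued points leaves one embedding of the residue extension into an
algebraic closure, so the extension is purely inseparable. Clearing denominators gives the element
form; `p` is the exponential characteristic. -/
lemma isRadicial_of_ringHom_ext {A B : Type u} [CommRing A] [CommRing B] [Algebra A B]
    [Algebra.IsIntegral A B]
    (h : ∀ (K : Type u) [Field K] (g₁ g₂ : B →+* K),
      g₁.comp (algebraMap A B) = g₂.comp (algebraMap A B) → g₁ = g₂)
    (hinj : Function.Injective (PrimeSpectrum.comap (algebraMap A B))) : IsRadicial A B where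
  eq_of_comap_eq P Q hP hQ e :=
    congrArg PrimeSpectrum.asIdeal (@hinj ⟨P, hP⟩ ⟨Q, hQ⟩ (PrimeSpectrum.ext e))
  exists_pow_sub_mem Q hQ b := by
    let q := Q.comap (algebraMap A B)
    let φ : q.ResidueField →+* Q.ResidueField := Ideal.ResidueField.map q Q (algebraMap A B) rfl
    have hφ (a : A) : φ (algebraMap A _ a) = algebraMap B _ (algebraMap A B a) :=
      Ideal.ResidueField.map_algebraMap ..
    let := φ.toAlgebra
    have hpi : IsPurelyInseparable q.ResidueField Q.ResidueField := by
      rw [isPurelyInseparable_iff_subsingleton_emb, Field.Emb]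
      refine ⟨fun σ τ => ?_⟩
      apply AlgHom.coe_ringHom_injective
      refine Ideal.ResidueField.ringHom_ext (h _ _ _ ?_)
      ext a
      have hσ := σ.commutes (algebraMap A _ a)
      have hτ := τ.commutes (algebraMap A _ a)
      simp only [RingHom.algebraMap_toAlgebra φ, hφ] at hσ hτ
      exact hσ.trans hτ.symm
    obtain ⟨p, hp⟩ := ExpChar.exists q.ResidueField
    obtain ⟨n, z, hz⟩ := IsPurelyInseparable.pow_mem q.ResidueField p (algebraMap B Q.ResidueField b)
    obtain ⟨a, s, hs, rfl⟩ := IsFractionRing.div_surjective (A := A ⧸ q) z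
    obtain ⟨a, rfl⟩ := Ideal.Quotient.mk_surjective a
    obtain ⟨s, rfl⟩ := Ideal.Quotient.mk_surjective s
    rw [RingHom.algebraMap_toAlgebra φ, map_div₀] at hz
    simp only [Ideal.algebraMap_quotient_residueField_mk, hφ] at hz
    have hsQ : algebraMap A B s ∉ Q := fun h => by
      refine nonZeroDivisors.ne_zero hs ?_
      rwa [Ideal.Quotient.eq_zero_iff_mem]
    refine ⟨s, a, p, n, hsQ, ?_, ?_⟩
    · cases hp with
      | zero => exact Or.inl rfl
      | prime hp' =>
        refine Or.inr ⟨hp', ?_⟩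
        rw [← Ideal.algebraMap_residueField_eq_zero, map_natCast, ← map_natCast φ,
          CharP.cast_eq_zero, map_zero]
    · have hs0 : algebraMap B Q.ResidueField (algebraMap A B s) ≠ 0 := by
        rwa [Ne, Ideal.algebraMap_residueField_eq_zero]
      rw [div_eq_iff hs0] at hz
      rw [← Ideal.algebraMap_residueField_eq_zero, map_sub, map_mul, map_pow, hz]
      ring

/-! ### Weak hulls of ring maps -/

section WeakHull

variable {A A' P P' : Type*} [CommRing A] [CommRing A'] [CommRing P] [CommRing P']

/-- The elements `t` with `t ^ 2, t ^ 3` or, for some prime `p`, `p * t, t ^ p` in the image. -/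
def weakGenerators (φ : A →+* P) : Set P :=
  {t | (t ^ 2 ∈ φ.range ∧ t ^ 3 ∈ φ.range) ∨
    ∃ p : ℕ, p.Prime ∧ (p : P) * t ∈ φ.range ∧ t ^ p ∈ φ.range}

/-- The subring generated by the image of `φ` and `weakGenerators φ`. -/
def weakHull (φ : A →+* P) : Subring P :=
  Subring.closure (φ.range ∪ weakGenerators φ)

lemma range_le_weakHull (φ : A →+* P) : φ.range ≤ weakHull φ :=
  fun _ hx => Subring.subset_closure (Or.inl hx)

lemma weakGenerators_subset_weakHull (φ : A →+* P) : weakGenerators φ ⊆ weakHull φ :=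
  fun _ hx => Subring.subset_closure (Or.inr hx)

/-- The corestriction of `φ` to its weak hull. -/
def toWeakHull (φ : A →+* P) : A →+* weakHull φ :=
  φ.codRestrict _ fun a => range_le_weakHull φ ⟨a, rfl⟩

@[simp]
lemma coe_toWeakHull (φ : A →+* P) (a : A) : (toWeakHull φ a : P) = φ a := rfl

lemma map_mem_weakHull {φ : A →+* P} {φ' : A' →+* P'} (r : A →+* A') (ρ : P →+* P')
    (h : ρ.comp φ = φ'.comp r) {x : P} (hx : x ∈ weakHull φ) : ρ x ∈ weakHull φ' := by
  have hr {y : P} (hy : y ∈ φ.range) : ρ y ∈ φ'.range := by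
    obtain ⟨a, rfl⟩ := hy
    exact ⟨r a, (RingHom.congr_fun h a).symm⟩
  suffices weakHull φ ≤ (weakHull φ').comap ρ from this hx
  refine Subring.closure_le.mpr ?_
  rintro y (hy | ⟨h2, h3⟩ | ⟨p, hp, h1, h2⟩)
  · exact range_le_weakHull _ (hr hy)
  · refine weakGenerators_subset_weakHull _ (Or.inl ⟨?_, ?_⟩)
    · rw [← map_pow]; exact hr h2
    · rw [← map_pow]; exact hr h3
  · refine weakGenerators_subset_weakHull _ (Or.inr ⟨p, hp, ?_, ?_⟩)
    · rw [← map_natCast ρ, ← map_mul]; exact hr h1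
    · rw [← map_pow]; exact hr h2

lemma toWeakHull_isIntegral (φ : A →+* P) : (toWeakHull φ).IsIntegral := by
  algebraize [φ]
  have key : weakHull φ ≤ (integralClosure A P).toSubring := by
    have hr {y : P} (hy : y ∈ φ.range) : IsIntegral A y := by
      obtain ⟨a, rfl⟩ := hy
      exact isIntegral_algebraMap
    refine Subring.closure_le.mpr ?_
    rintro y (hy | ⟨h2, h3⟩ | ⟨p, hp, h1, h2⟩)
    · exact hr hy
    · exact IsIntegral.of_pow two_pos (hr h2)
    · exact IsIntegral.of_pow hp.pos (hr h2)
  intro x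
  obtain ⟨f, hf, hx⟩ := key x.2
  refine ⟨f, hf, Subtype.ext ?_⟩
  rw [← Subring.coe_subtype, Polynomial.hom_eval₂]
  exact hx

/-- In a field, an element is determined by its square and cube, and also by its `p`-th power and
`p`-multiple, so values on generators are forced. -/
lemma ringHom_ext_of_comp_toWeakHull {φ : A →+* P} {K : Type*} [Field K]
    {g₁ g₂ : weakHull φ →+* K} (h : g₁.comp (toWeakHull φ) = g₂.comp (toWeakHull φ)) :
    g₁ = g₂ := by
  have hr (y : weakHull φ) (hy : (y : P) ∈ φ.range) : g₁ y = g₂ y := by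
    obtain ⟨a, ha⟩ := hy
    obtain rfl : toWeakHull φ a = y := Subtype.ext ha
    exact RingHom.congr_fun h a
  have key : ∀ x (hx : x ∈ weakHull φ), g₁ ⟨x, hx⟩ = g₂ ⟨x, hx⟩ := by
    intro x hx
    induction hx using Subring.closure_induction with
    | mem x hx =>
      have hx' : x ∈ weakHull φ := Subring.subset_closure hx
      rcases hx with hx | ⟨h2, h3⟩ | ⟨p, hp, h1, h2⟩
      · exact hr _ hx
      · exact eq_of_sq_eq_of_cube_eq
          (by rw [← map_pow, ← map_pow]; exact hr (⟨x, hx'⟩ ^ 2) h2)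
          (by rw [← map_pow, ← map_pow]; exact hr (⟨x, hx'⟩ ^ 3) h3)
      · exact eq_of_pow_eq_of_mul_eq hp
          (by rw [← map_pow, ← map_pow]; exact hr (⟨x, hx'⟩ ^ p) h2)
          (by rw [← map_natCast g₁, ← map_mul, map_natCast, ← map_natCast g₂, ← map_mul]
              exact hr (p * ⟨x, hx'⟩) h1)
    | zero => exact (map_zero g₁).trans (map_zero g₂).symm
    | one => exact (map_one g₁).trans (map_one g₂).symm
    | add x y hx hy h1 h2 =>
      have := congrArg₂ (· + ·) h1 h2
      simp only [← map_add] at this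
      exact this
    | neg x hx h1 =>
      have := congrArg Neg.neg h1
      simp only [← map_neg] at this
      exact this
    | mul x y hx hy h1 h2 =>
      have := congrArg₂ (· * ·) h1 h2
      simp only [← map_mul] at this
      exact this
  exact RingHom.ext fun x => key x.1 x.2

lemma specComap_toWeakHull_surjective (φ : A →+* P) (hφ : ∀ a, φ a = 0 → IsNilpotent a) :
    Function.Surjective (PrimeSpectrum.comap (toWeakHull φ)) := by
  intro P
  algebraize [toWeakHull φ]
  have : Algebra.IsIntegral A (weakHull φ) := ⟨toWeakHull_isIntegral φ⟩
  obtain ⟨Q, -, hQ, h⟩ := Ideal.exists_ideal_over_prime_of_isIntegral P.asIdeal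
    (⊥ : Ideal (weakHull φ)) (fun a ha => by
      have h0 : φ a = 0 := congrArg Subtype.val ha
      exact nilradical_le_prime _ (hφ a h0))
  exact ⟨⟨Q, hQ⟩, PrimeSpectrum.ext h⟩

/-! ### Weak hulls commute with localization, given an extension by zero `ε` -/

section Localization

variable {φ : A →+* P} {φ' : A' →+* P'} [Algebra A A'] {ρ : P →+* P'} {f : A}
  (h : ρ.comp φ = φ'.comp (algebraMap A A')) (ε : P' →ₙ+* P)
  (hρε : ∀ t, ρ (ε t) = t) (hερ : ∀ z, ε (ρ (φ f * z)) = φ f * z)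

lemma nonUnitalRingHom_map_pow (t : P') {n : ℕ} (hn : n ≠ 0) : ε (t ^ n) = ε t ^ n := by
  obtain ⟨n, rfl⟩ := Nat.exists_eq_succ_of_ne_zero hn
  clear hn
  induction n with
  | zero => simp
  | succ n ih => rw [Nat.succ_eq_add_one, pow_succ, map_mul, ih, ← pow_succ]

lemma nonUnitalRingHom_map_natCast_mul (t : P') (n : ℕ) : ε (n * t) = n * ε t := by
  rw [← nsmul_eq_mul, ← nsmul_eq_mul, map_nsmul]

include h hερ in
-- The power `N` clears the denominator; the one extra factor `f` lets `hερ` identify the extension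
-- by zero with an actual value of `φ`.
lemma extend_mem_range {x' : A'} {x : A} {N : ℕ} (hx : algebraMap A A' f ^ N * x' = algebraMap A A' x)
    {m : ℕ} (hm : N + 1 ≤ m) : ε (φ' (algebraMap A A' f) ^ m * φ' x') ∈ φ.range := by
  obtain ⟨k, rfl⟩ := Nat.exists_eq_add_of_le hm
  have : φ' (algebraMap A A' f) ^ (N + 1 + k) * φ' x' = ρ (φ f * φ (f ^ k * x)) := by
    have h' (a : A) : ρ (φ a) = φ' (algebraMap A A' a) := RingHom.congr_fun h a
    rw [← map_mul, h', ← map_pow, ← map_mul]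
    congr 1
    simp only [map_mul, map_pow, ← hx]
    ring
  rw [this, hερ]
  exact mul_mem ⟨_, rfl⟩ ⟨_, rfl⟩

include h hρε hερ in
lemma exists_pow_mul_eq_of_mem_weakHull [IsLocalization.Away f A'] {t : P'} (ht : t ∈ weakHull φ') :
    ∃ (n : ℕ), ∃ s ∈ weakHull φ, ρ s = φ' (algebraMap A A' f) ^ n * t := by
  have h' (a : A) : ρ (φ a) = φ' (algebraMap A A' a) := RingHom.congr_fun h a
  have num (x' : A') : ∃ (N : ℕ) (x : A), algebraMap A A' f ^ N * x' = algebraMap A A' x := by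
    obtain ⟨N, x, hx⟩ := IsLocalization.Away.surj f x'
    exact ⟨N, x, by rw [mul_comm, hx]⟩
  have num₂ (x' y' : A') : ∃ (N : ℕ) (x y : A), algebraMap A A' f ^ N * x' = algebraMap A A' x ∧
      algebraMap A A' f ^ N * y' = algebraMap A A' y := by
    obtain ⟨N, x, hx⟩ := num x'
    obtain ⟨M, y, hy⟩ := num y'
    refine ⟨N + M, f ^ M * x, f ^ N * y, ?_, ?_⟩
    · rw [map_mul, map_pow, ← hx]; ring
    · rw [map_mul, map_pow, ← hy]; ring
  induction ht using Subring.closure_induction with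
  | mem t ht =>
    rcases ht with ⟨x', rfl⟩ | ⟨⟨x', hx'⟩, ⟨y', hy'⟩⟩ | ⟨p, hp, ⟨y', hy'⟩, ⟨x', hx'⟩⟩
    · obtain ⟨N, x, hx⟩ := num x'
      exact ⟨N, φ x, range_le_weakHull _ ⟨x, rfl⟩, by rw [h', ← hx, map_mul, map_pow]⟩
    · obtain ⟨N, x, y, hx, hy⟩ := num₂ x' y'
      -- Extending by zero turns a generator downstairs, scaled by a power of `f`, into a generator
      -- of the hull of `φ`.
      refine ⟨N + 1, ε (φ' (algebraMap A A' f) ^ (N + 1) * t),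
        weakGenerators_subset_weakHull _ (Or.inl ⟨?_, ?_⟩), hρε _⟩
      · rw [← nonUnitalRingHom_map_pow _ _ two_ne_zero, mul_pow, ← pow_mul, ← hx']
        exact extend_mem_range h ε hερ hx (by omega)
      · rw [← nonUnitalRingHom_map_pow _ _ three_ne_zero, mul_pow, ← pow_mul, ← hy']
        exact extend_mem_range h ε hερ hy (by omega)
    · obtain ⟨N, x, y, hx, hy⟩ := num₂ x' y'
      refine ⟨N + 1, ε (φ' (algebraMap A A' f) ^ (N + 1) * t),
        weakGenerators_subset_weakHull _ (Or.inr ⟨p, hp, ?_, ?_⟩), hρε _⟩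
      · rw [← nonUnitalRingHom_map_natCast_mul, mul_left_comm, ← hy']
        exact extend_mem_range h ε hερ hy le_rfl
      · rw [← nonUnitalRingHom_map_pow _ _ hp.ne_zero, mul_pow, ← pow_mul, ← hx']
        exact extend_mem_range h ε hερ hx (Nat.le_mul_of_pos_right _ hp.pos)
  | zero => exact ⟨0, 0, zero_mem _, by simp⟩
  | one => exact ⟨0, 1, one_mem _, by simp⟩
  | add t u _ _ ht hu =>
    obtain ⟨n, s, hs, hst⟩ := ht
    obtain ⟨m, v, hv, hvu⟩ := hu
    refine ⟨n + m, φ f ^ m * s + φ f ^ n * v, add_mem (mul_mem (pow_mem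
      (range_le_weakHull _ ⟨f, rfl⟩) _) hs) (mul_mem (pow_mem (range_le_weakHull _ ⟨f, rfl⟩) _) hv), ?_⟩
    rw [map_add, map_mul, map_mul, map_pow, map_pow, h', hst, hvu]; ring
  | neg t _ ht =>
    obtain ⟨n, s, hs, hst⟩ := ht
    exact ⟨n, -s, neg_mem hs, by rw [map_neg, hst]; ring⟩
  | mul t u _ _ ht hu =>
    obtain ⟨n, s, hs, hst⟩ := ht
    obtain ⟨m, v, hv, hvu⟩ := hu
    exact ⟨n + m, s * v, mul_mem hs hv, by rw [map_mul, hst, hvu]; ring⟩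

include h hρε hερ in
lemma isLocalizationAway_weakHull [IsLocalization.Away f A'] [Algebra (weakHull φ) (weakHull φ')]
    (hmap : ∀ s, (algebraMap (weakHull φ) (weakHull φ') s : P') = ρ s) :
    IsLocalization.Away (toWeakHull φ f) (weakHull φ') := by
  have h' (a : A) : ρ (φ a) = φ' (algebraMap A A' a) := RingHom.congr_fun h a
  have hf : algebraMap (weakHull φ) (weakHull φ') (toWeakHull φ f) =
      toWeakHull φ' (algebraMap A A' f) := Subtype.ext (by rw [hmap]; exact h' f)
  refine ⟨?_, ?_, ?_⟩
  · rintro ⟨_, n, rfl⟩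
    rw [map_pow, hf]
    exact ((IsLocalization.Away.algebraMap_isUnit f).map _).pow n
  · intro t
    obtain ⟨n, s, hs, hst⟩ := exists_pow_mul_eq_of_mem_weakHull h ε hρε hερ t.2
    refine ⟨⟨⟨s, hs⟩, ⟨_, n, rfl⟩⟩, Subtype.ext ?_⟩
    rw [hmap, map_pow, hf, hst]
    simp [mul_comm]
  · intro x y hxy
    refine ⟨⟨toWeakHull φ f, Submonoid.mem_powers _⟩, Subtype.ext ?_⟩
    have h0 : ρ (x - y) = 0 := by
      rw [map_sub, ← hmap, ← hmap, hxy, sub_self]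
    have := hερ (x - y)
    rw [map_mul, h0, mul_zero, map_zero] at this
    rw [← sub_eq_zero, Subring.coe_mul, Subring.coe_mul, coe_toWeakHull, ← mul_sub, ← this]

end Localization

end WeakHull

lemma universalHomeomorphism_of_isIntegralHom {X Y : Scheme.{u}} (f : X ⟶ Y) [IsIntegralHom f]
    [UniversallyInjective f] [Surjective f] : UniversalHomeomorphism f := by
  intro X' Y' i₁ i₂ f' h
  have : IsIntegralHom f' := MorphismProperty.of_isPullback h.flip ‹_›
  have : UniversallyInjective f' := MorphismProperty.of_isPullback h.flip ‹_›
  have : Surjective f' := MorphismProperty.of_isPullback h.flip ‹_›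
  exact isHomeomorph_iff_continuous_isClosedMap_bijective.mpr
    ⟨f'.continuous, f'.isClosedMap, f'.injective, f'.surjective⟩

/-! ### The weak hull of a scheme, and rigid implies weakly normal -/

section WeakHull

variable (Y : Scheme.{u})

/-- Functions on `U` with values in the algebraic closures of the residue fields. -/
abbrev GeometricFunctions (U : Y.Opens) : Type u :=
  (y : U) → AlgebraicClosure (Y.residueField y.1)

variable {Y}

/-- Evaluation of a section at all points. -/
noncomputable def evalAll (U : Y.Opens) : Γ(Y, U) →+* GeometricFunctions Y U :=
  RingHom.pi fun y => (algebraMap (Y.residueField y.1) _).comp (Y.evaluation U y.1 y.2).hom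

lemma evalAll_apply (U : Y.Opens) (a : Γ(Y, U)) (y : U) :
    evalAll U a y = algebraMap (Y.residueField y.1) _ (Y.evaluation U y.1 y.2 a) := rfl

/-- Restriction of functions to a smaller open. -/
def restrictFunctions {U V : Y.Opens} (h : V ≤ U) :
    GeometricFunctions Y U →+* GeometricFunctions Y V where
  toFun t y := t ⟨y.1, h y.2⟩
  map_one' := rfl
  map_mul' _ _ := rfl
  map_zero' := rfl
  map_add' _ _ := rfl

@[simp]
lemma restrictFunctions_apply {U V : Y.Opens} (h : V ≤ U) (t : GeometricFunctions Y U) (y : V) :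
    restrictFunctions h t y = t ⟨y.1, h y.2⟩ := rfl

lemma restrictFunctions_comp_evalAll {U V : Y.Opens} (i : V ⟶ U) :
    (restrictFunctions i.le).comp (evalAll U) =
      (evalAll V).comp (Y.presheaf.map i.op).hom := by
  ext a y
  simp only [RingHom.comp_apply, restrictFunctions_apply, evalAll_apply]
  congr 1
  have : Y.presheaf.map i.op ≫ Y.evaluation V y.1 y.2 = Y.evaluation U y.1 (i.le y.2) := by
    rw [← Scheme.germ_residue, ← Scheme.germ_residue, TopCat.Presheaf.germ_res_assoc]
  exact (congr($(this).hom a)).symm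

open Classical in
/-- Extension of functions by zero. -/
noncomputable def extendFunctions (U V : Y.Opens) :
    GeometricFunctions Y V →ₙ+* GeometricFunctions Y U where
  toFun t y := if h : y.1 ∈ V then t ⟨y.1, h⟩ else 0
  map_mul' s t := by ext y; by_cases h : y.1 ∈ V <;> simp [h]
  map_zero' := by ext y; by_cases h : y.1 ∈ V <;> simp [h]
  map_add' s t := by ext y; by_cases h : y.1 ∈ V <;> simp [h]

lemma restrictFunctions_extendFunctions {U V : Y.Opens} (h : V ≤ U) (t : GeometricFunctions Y V) :
    restrictFunctions h (extendFunctions U V t) = t := by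
  ext y
  exact dif_pos y.2

lemma extendFunctions_restrictFunctions_mul {U : Y.Opens} (f : Γ(Y, U))
    (z : GeometricFunctions Y U) :
    extendFunctions U (Y.basicOpen f) (restrictFunctions (Y.basicOpen_le f) (evalAll U f * z)) =
      evalAll U f * z := by
  ext y
  by_cases h : y.1 ∈ Y.basicOpen f
  · exact dif_pos h
  · refine (dif_neg h).trans ?_
    rw [Pi.mul_apply, evalAll_apply,
      (Y.evaluation_eq_zero_iff_notMem_basicOpen y.1 y.2 f).mpr h, map_zero, zero_mul]

variable (Y) in
/-- The presheaf of weak hulls of the structure presheaf in the geometric functions. -/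
noncomputable def weakHullPresheaf : Y.Opensᵒᵖ ⥤ CommRingCat.{u} where
  obj U := .of (weakHull (evalAll U.unop))
  map i := CommRingCat.ofHom ((restrictFunctions i.unop.le).restrict _ _ fun _ hx =>
    map_mem_weakHull _ _ (restrictFunctions_comp_evalAll i.unop) hx)

variable (Y) in
/-- The map from the structure presheaf to the presheaf of weak hulls. -/
noncomputable def toWeakHullPresheaf : Y.presheaf ⟶ weakHullPresheaf Y where
  app U := CommRingCat.ofHom (toWeakHull (evalAll U.unop))
  naturality U V i := by
    ext x
    exact Subtype.ext (RingHom.congr_fun (restrictFunctions_comp_evalAll i.unop) x).symm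

open Scheme.AffineZariskiSite

variable (Y) in
lemma coequifibered_toWeakHullPresheaf :
    ((toOpensFunctor Y).op.whiskerLeft (toWeakHullPresheaf Y)).Coequifibered := by
  refine coequifibered_iff_forall_isLocalizationAway.mpr fun U r ↦ ?_
  let : Algebra Γ(Y, U.1) Γ(Y, Y.basicOpen r) :=
    (Y.presheaf.map (homOfLE (Y.basicOpen_le r)).op).hom.toAlgebra
  have : IsLocalization.Away r Γ(Y, Y.basicOpen r) := U.2.isLocalization_basicOpen _
  let : Algebra (weakHull (evalAll U.1)) (weakHull (evalAll (Y.basicOpen r))) :=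
    ((weakHullPresheaf Y).map (homOfLE (Y.basicOpen_le r)).op).hom.toAlgebra
  exact isLocalizationAway_weakHull (φ := evalAll U.1) (φ' := evalAll (Y.basicOpen r))
    (ρ := restrictFunctions (Y.basicOpen_le r))
    (restrictFunctions_comp_evalAll (homOfLE (Y.basicOpen_le r)))
    (extendFunctions _ _) (restrictFunctions_extendFunctions _)
    (extendFunctions_restrictFunctions_mul r) (fun s => rfl)

variable (Y) in
/-- The gluing datum of the spectra of the weak hulls. -/
noncomputable def weakHullGlueData := relativeGluingData (coequifibered_toWeakHullPresheaf Y)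

instance : ((weakHullGlueData Y).functor ⋙ Scheme.forget).IsLocallyDirected :=
  Scheme.Cover.RelativeGluingData.instIsLocallyDirectedI₀CompFunctorForgetOfIsThin ..

variable (Y) in
/-- The relative spectrum of the weak hulls. -/
noncomputable def weakHullScheme : Scheme.{u} := (weakHullGlueData Y).glued

variable (Y) in
/-- The structure morphism of the relative spectrum of the weak hulls. -/
noncomputable def fromWeakHullScheme : weakHullScheme Y ⟶ Y := (weakHullGlueData Y).toBase

variable (Y) in
/-- The affine cover of the relative spectrum of the weak hulls. -/
noncomputable def weakHullOpenCover : (weakHullScheme Y).OpenCover := (weakHullGlueData Y).cover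

/-- The inclusion of the part of the relative spectrum over an affine open. -/
noncomputable def weakHullι {U : Y.Opens} (hU : IsAffineOpen U) :
    Spec (.of (weakHull (evalAll U))) ⟶ weakHullScheme Y :=
  (weakHullOpenCover Y).f ⟨U, hU⟩

instance {U : Y.Opens} (hU : IsAffineOpen U) : IsOpenImmersion (weakHullι hU) :=
  (weakHullOpenCover Y).map_prop ⟨U, hU⟩

lemma weakHullι_fromWeakHullScheme {U : Y.Opens} (hU : IsAffineOpen U) :
    weakHullι hU ≫ fromWeakHullScheme Y =
      Spec.map (CommRingCat.ofHom (toWeakHull (evalAll U))) ≫ hU.fromSpec :=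
  colimit.ι_desc _ _

lemma fromWeakHullScheme_preimage {U : Y.Opens} (hU : IsAffineOpen U) :
    fromWeakHullScheme Y ⁻¹ᵁ U = (weakHullι hU).opensRange := by
  have := (weakHullGlueData Y).toBase_preimage_eq_opensRange_ι ⟨U, hU⟩
  exact (congrArg (fromWeakHullScheme Y ⁻¹ᵁ ·) (Scheme.Opens.opensRange_ι U).symm).trans this

/-- This reduces properties local on the target to the ring maps `toWeakHull`. -/
lemma nonempty_arrowIso_fromWeakHullScheme {U : Y.Opens} (hU : IsAffineOpen U) :
    Nonempty (Arrow.mk (fromWeakHullScheme Y ∣_ U) ≅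
      Arrow.mk (Spec.map (CommRingCat.ofHom (toWeakHull (evalAll U))))) := by
  let e := IsOpenImmersion.isoOfRangeEq (fromWeakHullScheme Y ⁻¹ᵁ U).ι (weakHullι hU)
      (by simpa using congr($(fromWeakHullScheme_preimage hU).1))
  refine ⟨Arrow.isoMk e hU.isoSpec ?_⟩
  dsimp
  rw [← cancel_mono hU.fromSpec, Category.assoc, Category.assoc, ← weakHullι_fromWeakHullScheme]
  simp [IsAffineOpen.isoSpec_hom, e]

lemma fromWeakHullScheme_of_forall (P : MorphismProperty Scheme.{u}) [IsZariskiLocalAtTarget P]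
    (h : ∀ U : Y.Opens, IsAffineOpen U →
      P (Spec.map (CommRingCat.ofHom (toWeakHull (evalAll U))))) : P (fromWeakHullScheme Y) := by
  rw [IsZariskiLocalAtTarget.iff_of_iSup_eq_top (P := P) _ (iSup_affineOpens_eq_top _)]
  intro U
  obtain ⟨e⟩ := nonempty_arrowIso_fromWeakHullScheme U.2
  exact (P.arrow_mk_iso_iff e).mpr (h U.1 U.2)

lemma isNilpotent_of_evalAll_eq_zero {U : Y.Opens} (hU : IsAffineOpen U) {a : Γ(Y, U)}
    (ha : evalAll U a = 0) : IsNilpotent a := by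
  rw [Scheme.isNilpotent_iff_basicOpen_eq_bot_of_isCompact hU.isCompact,
    Y.basicOpen_eq_bot_iff_forall_evaluation_eq_zero]
  intro y
  have := congrFun ha y
  rw [evalAll_apply, Pi.zero_apply, map_eq_zero] at this
  exact this

variable (Y) in
lemma universalHomeomorphism_fromWeakHullScheme :
    UniversalHomeomorphism (fromWeakHullScheme Y) := by
  have : IsZariskiLocalAtTarget @IsIntegralHom :=
    @HasAffineProperty.instIsZariskiLocalAtTarget _ _ IsIntegralHom.hasAffineProperty
  have : IsIntegralHom (fromWeakHullScheme Y) := fromWeakHullScheme_of_forall (P := @IsIntegralHom)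
    fun U _ => IsIntegralHom.SpecMap_iff.mpr (toWeakHull_isIntegral _)
  have : UniversallyInjective (fromWeakHullScheme Y) :=
    fromWeakHullScheme_of_forall @UniversallyInjective fun U _ => by
      refine ((tfae_universallyInjective _).out 0 1).mpr ?_
      intro K _ g₁ g₂ h
      obtain ⟨g₁, rfl⟩ := Spec.map_surjective g₁
      obtain ⟨g₂, rfl⟩ := Spec.map_surjective g₂
      simp only [← Spec.map_comp] at h
      have h' := congr($(Spec.map_injective h).hom)
      let γ₁ : weakHull (evalAll U) →+* K := g₁.hom
      let γ₂ : weakHull (evalAll U) →+* K := g₂.hom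
      have : γ₁ = γ₂ := ringHom_ext_of_comp_toWeakHull h'
      exact congrArg Spec.map (CommRingCat.hom_ext this)
  have : Surjective (fromWeakHullScheme Y) :=
    fromWeakHullScheme_of_forall @Surjective fun U hU =>
      ⟨specComap_toWeakHull_surjective _ fun a ha => isNilpotent_of_evalAll_eq_zero hU ha⟩
  exact universalHomeomorphism_of_isIntegralHom _

instance isReduced_weakHullScheme : IsReduced (weakHullScheme Y) := by
  have (U : (weakHullOpenCover Y).I₀) : IsReduced ((weakHullOpenCover Y).X U) := by
    have : _root_.IsReduced (weakHull (evalAll U.1)) :=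
      isReduced_of_injective (Subring.subtype _) Subtype.val_injective
    exact inferInstanceAs (IsReduced (Spec (.of (weakHull (evalAll U.1)))))
  exact IsReduced.of_openCover _ (weakHullOpenCover Y)

/-- If `p` is invertible take `y / p`. Otherwise `y = 0` and a `p`-th root of `x` is needed, which
is why geometric functions use algebraic closures. -/
lemma exists_pow_eq_and_mul_eq {K : Type*} [Field K] [IsAlgClosed K] {p : ℕ} (hp : p.Prime)
    {x y : K} (h : (p : K) ^ p * x = y ^ p) : ∃ a, a ^ p = x ∧ p * a = y := by
  by_cases hp0 : (p : K) = 0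
  · obtain ⟨a, ha⟩ := IsAlgClosed.exists_pow_nat_eq x hp.pos
    refine ⟨a, ha, ?_⟩
    rw [hp0, zero_pow hp.ne_zero, zero_mul, eq_comm] at h
    rw [hp0, zero_mul, eq_zero_of_pow_eq_zero h]
  · refine ⟨y / p, ?_, mul_div_cancel₀ _ hp0⟩
    rw [div_pow, ← h, mul_div_cancel_left₀ _ (pow_ne_zero _ hp0)]

lemma exists_sq_eq_and_cube_eq {K : Type*} [Field K] {x y : K} (h : x ^ 3 = y ^ 2) :
    ∃ a, a ^ 2 = x ∧ a ^ 3 = y := by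
  by_cases hx : x = 0
  · subst hx
    refine ⟨0, by simp, ?_⟩
    rw [zero_pow three_ne_zero, eq_comm] at h
    simp [eq_zero_of_pow_eq_zero h]
  · refine ⟨y / x, ?_, ?_⟩
    · rw [div_pow, ← h]; field_simp
    · rw [div_pow, h]
      have hy : y ≠ 0 := by rintro rfl; simp [hx] at h
      field_simp

/-- Rigidity identifies `Y` with its weak hull. Solutions chosen point by point form a weak
generator, hence a section. -/
lemma IsTopologicallyRigid.isAbsWeaklyNormal (hY : IsTopologicallyRigid Y) {U : Y.Opens}
    (hU : IsAffineOpen U) : IsAbsWeaklyNormal Γ(Y, U) := by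
  have hiso : IsIso (fromWeakHullScheme Y) := hY.isIso_of_universalHomeomorphism _ _ inferInstance
    (universalHomeomorphism_fromWeakHullScheme Y)
  have hbij : Function.Bijective (toWeakHull (evalAll U)) := by
    obtain ⟨e⟩ := nonempty_arrowIso_fromWeakHullScheme hU
    refine (isIso_SpecMap_iff (f := CommRingCat.ofHom (toWeakHull (evalAll U)))).mp ?_
    exact ((MorphismProperty.isomorphisms _).arrow_mk_iso_iff e).mp
      (inferInstanceAs (IsIso (fromWeakHullScheme Y ∣_ U)))
  have hinj : Function.Injective (evalAll U) := Subtype.val_injective.comp hbij.1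
  have hsurj {t : GeometricFunctions Y U} (ht : t ∈ weakGenerators (evalAll U)) :
      ∃ a, evalAll U a = t := by
    obtain ⟨a, ha⟩ := hbij.2 ⟨t, weakGenerators_subset_weakHull _ ht⟩
    exact ⟨a, congrArg Subtype.val ha⟩
  refine ⟨isReduced_of_injective _ hinj, fun x y h => ?_, fun p hp x y h => ?_⟩
  · have h' (z : U) : (evalAll U x z) ^ 3 = (evalAll U y z) ^ 2 := by
      simpa only [map_pow, Pi.pow_apply] using congrFun (congrArg (evalAll U) h) z
    choose t ht2 ht3 using fun z => exists_sq_eq_and_cube_eq (h' z)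
    have h2 : evalAll U x = t ^ 2 := funext fun z => (ht2 z).symm
    have h3 : evalAll U y = t ^ 3 := funext fun z => (ht3 z).symm
    obtain ⟨a, rfl⟩ := hsurj (t := t) (Or.inl ⟨⟨x, h2⟩, ⟨y, h3⟩⟩)
    exact ⟨a, hinj (by rw [map_pow, h2]), hinj (by rw [map_pow, h3])⟩
  · have h' (z : U) : (p : AlgebraicClosure (Y.residueField z.1)) ^ p * evalAll U x z =
        (evalAll U y z) ^ p := by
      simpa only [map_pow, map_mul, map_natCast, Pi.pow_apply, Pi.mul_apply, Pi.natCast_apply] using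
        congrFun (congrArg (evalAll U) h) z
    choose t ht1 ht2 using fun z => exists_pow_eq_and_mul_eq hp (h' z)
    have h1 : evalAll U x = t ^ p := funext fun z => (ht1 z).symm
    have h2 : evalAll U y = p * t := funext fun z => (ht2 z).symm
    obtain ⟨a, rfl⟩ := hsurj (t := t) (Or.inr ⟨p, hp, ⟨y, h2⟩, ⟨x, h1⟩⟩)
    exact ⟨a, hinj (by rw [map_pow, h1]), hinj (by rw [map_mul, map_natCast, h2])⟩

end WeakHull

lemma IsAbsWeaklyNormal.of_ringEquiv {A B : Type*} [CommRing A] [CommRing B] (e : A ≃+* B)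
    (hA : IsAbsWeaklyNormal A) : IsAbsWeaklyNormal B where
  isReduced := have := hA.isReduced; isReduced_of_injective e.symm e.symm.injective
  exists_sq_cube x y h := by
    obtain ⟨a, h2, h3⟩ := hA.exists_sq_cube (e.symm x) (e.symm y) (by
      rw [← map_pow, ← map_pow, h])
    exact ⟨e a, by rw [← map_pow, h2, e.apply_symm_apply],
      by rw [← map_pow, h3, e.apply_symm_apply]⟩
  exists_pow_mul p hp x y h := by
    obtain ⟨a, h1, h2⟩ := hA.exists_pow_mul p hp (e.symm x) (e.symm y) (by
      rw [← map_natCast e.symm, ← map_pow, ← map_pow, ← map_mul, h])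
    exact ⟨e a, by rw [← map_pow, h1, e.apply_symm_apply],
      by rw [← map_natCast e, ← map_mul, h2, e.apply_symm_apply]⟩

/-! ### Weakly normal implies rigid -/

section Descent

variable {X Y : Scheme.{u}} {f : X ⟶ Y}

lemma UniversalHomeomorphism.isHomeomorph (hf : UniversalHomeomorphism f) : IsHomeomorph f :=
  hf _ _ _ .of_id_snd

lemma UniversalHomeomorphism.isIntegralHom (hf : UniversalHomeomorphism f) : IsIntegralHom f := by
  refine IsIntegralHom.iff_universallyClosed_and_isAffineHom.mpr ⟨⟨?_⟩, ?_⟩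
  · exact fun _ _ _ _ _ h => (hf _ _ _ h).isClosedMap
  · refine isAffineHom_of_isInducing f hf.isHomeomorph.isInducing ?_
    rw [hf.isHomeomorph.surjective.range_eq]
    exact isClosed_univ

lemma UniversalHomeomorphism.universallyInjective (hf : UniversalHomeomorphism f) :
    UniversallyInjective f :=
  ⟨fun _ _ _ _ _ h => (hf _ _ _ h).injective⟩

lemma UniversalHomeomorphism.surjective (hf : UniversalHomeomorphism f) : Surjective f :=
  ⟨hf.isHomeomorph.surjective⟩

lemma isIso_SpecMap_of_isAbsWeaklyNormal {A B : CommRingCat.{u}} (φ : A ⟶ B)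
    (hA : IsAbsWeaklyNormal A) [_root_.IsReduced B] [IsIntegralHom (Spec.map φ)]
    [UniversallyInjective (Spec.map φ)] [Surjective (Spec.map φ)] : IsIso (Spec.map φ) := by
  algebraize [φ.hom]
  have : Algebra.IsIntegral A B := ⟨IsIntegralHom.SpecMap_iff.mp ‹_›⟩
  -- Surjectivity on spectra puts the kernel inside every prime of the reduced ring `A`.
  have hinj : Function.Injective (algebraMap A B) := by
    have := hA.isReduced
    rw [injective_iff_map_eq_zero]
    intro a ha
    refine IsNilpotent.eq_zero ((mem_nilradical).mp ?_)
    rw [nilradical_eq_sInf, Ideal.mem_sInf]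
    intro P hP
    obtain ⟨Q, hQ⟩ := (Spec.map φ).surjective ⟨P, hP⟩
    have : P = Q.asIdeal.comap φ.hom := (congrArg PrimeSpectrum.asIdeal hQ).symm
    rw [this, Ideal.mem_comap]
    have h0 : φ.hom a = 0 := ha
    rw [h0]
    exact zero_mem _
  have hrad : IsRadicial A B := by
    refine isRadicial_of_ringHom_ext ?_ (Spec.map φ).injective
    intro K _ g₁ g₂ h
    have hinj : ∀ (K : Type u) [Field K],
        Function.Injective (fun g : Spec (.of K) ⟶ Spec B => g ≫ Spec.map φ) :=
      ((tfae_universallyInjective (Spec.map φ)).out 0 1).mp ‹_›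
    have : Spec.map (CommRingCat.ofHom g₁) = Spec.map (CommRingCat.ofHom g₂) := hinj K (by
      simp only [← Spec.map_comp]
      exact congrArg Spec.map (CommRingCat.hom_ext h))
    exact congr($(Spec.map_injective this).hom)
  exact isIso_SpecMap_iff.mpr ⟨hinj, hA.surjective_algebraMap hinj hrad⟩

lemma isIso_of_isAbsWeaklyNormal [IsAffine Y] (hY : IsAbsWeaklyNormal Γ(Y, ⊤)) [IsReduced X]
    [IsIntegralHom f] [UniversallyInjective f] [Surjective f] : IsIso f := by
  have : IsAffine X := isAffine_of_isAffineHom f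
  have : MorphismProperty.RespectsIso @IsIntegralHom :=
    MorphismProperty.IsStableUnderBaseChange.respectsIso
  have : MorphismProperty.RespectsIso @UniversallyInjective := UniversallyInjective.respectsIso
  let e := arrowIsoSpecΓOfIsAffine f
  have h1 : IsIntegralHom (Spec.map f.appTop) :=
    (MorphismProperty.arrow_mk_iso_iff @IsIntegralHom e).mp ‹_›
  have h2 : UniversallyInjective (Spec.map f.appTop) :=
    (MorphismProperty.arrow_mk_iso_iff @UniversallyInjective e).mp ‹_›
  have h3 : Surjective (Spec.map f.appTop) :=
    (MorphismProperty.arrow_mk_iso_iff @Surjective e).mp ‹_›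
  exact (MorphismProperty.arrow_mk_iso_iff (MorphismProperty.isomorphisms _) e).mpr
    (isIso_SpecMap_of_isAbsWeaklyNormal _ hY)

lemma isTopologicallyRigid_of_isAbsWeaklyNormal (hY : IsCoherent Y) {ι : Type*} (V : ι → Y.Opens)
    (hV : ⨆ i, V i = ⊤) (haff : ∀ i, IsAffine (V i)) (hawn : ∀ i, IsAbsWeaklyNormal Γ(V i, ⊤)) :
    IsTopologicallyRigid Y where
  isCoherent := hY
  isIso_of_universalHomeomorphism Y' f _ hf := by
    have := hf.isIntegralHom
    have := hf.universallyInjective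
    have := hf.surjective
    refine (IsZariskiLocalAtTarget.iff_of_iSup_eq_top (P := .isomorphisms _) V hV).mpr fun i => ?_
    have : UniversallyInjective (f ∣_ V i) := IsZariskiLocalAtTarget.restrict ‹_› _
    have : Surjective (f ∣_ V i) := IsZariskiLocalAtTarget.restrict ‹_› _
    exact isIso_of_isAbsWeaklyNormal (hawn i)

end Descent

/-! ### Cofiltered limits, locally over the base -/

section Limit

/-- Elements and equations on the limit already exist at some stage; solve there and pull back. -/
lemma isAbsWeaklyNormal_of_isLimit {J : Type u} [SmallCategory J] [IsCofiltered J]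
    (D : J ⥤ Scheme.{u}) (c : Cone D) (hc : IsLimit c) [∀ j, IsAffine (D.obj j)]
    (h : ∀ j, IsAbsWeaklyNormal Γ(D.obj j, ⊤)) : IsAbsWeaklyNormal Γ(c.pt, ⊤) := by
  have hw {i j : J} (f : i ⟶ j) (s : Γ(D.obj j, ⊤)) :
      (c.π.app i).appTop ((D.map f).appTop s) = (c.π.app j).appTop s := by
    rw [← c.w f, Scheme.Hom.comp_appTop]
    rfl
  have lift₂ (x y : Γ(c.pt, ⊤)) : ∃ (j : J) (x' y' : Γ(D.obj j, ⊤)),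
      (c.π.app j).appTop x' = x ∧ (c.π.app j).appTop y' = y := by
    obtain ⟨i, x', rfl⟩ := exists_appTop_π_eq_of_isAffine_of_isLimit D c hc x
    obtain ⟨j, y', rfl⟩ := exists_appTop_π_eq_of_isAffine_of_isLimit D c hc y
    exact ⟨IsCofiltered.min i j, (D.map (IsCofiltered.minToLeft i j)).appTop x',
      (D.map (IsCofiltered.minToRight i j)).appTop y', hw _ _, hw _ _⟩
  have eq {j : J} {x y : Γ(D.obj j, ⊤)} (h : (c.π.app j).appTop x = (c.π.app j).appTop y) :
      ∃ (i : J) (f : i ⟶ j), (D.map f).appTop x = (D.map f).appTop y := by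
    obtain ⟨i, f, hf⟩ := exists_appTop_map_eq_zero_of_isAffine_of_isLimit D c hc j (x - y) (by
      rw [map_sub, h, sub_self])
    exact ⟨i, f, by rwa [map_sub, sub_eq_zero] at hf⟩
  refine ⟨?_, fun x y hxy => ?_, fun p hp x y hxy => ?_⟩
  · rw [isReduced_iff_pow_one_lt 2 (by norm_num)]
    intro x hx
    obtain ⟨j, x, rfl⟩ := exists_appTop_π_eq_of_isAffine_of_isLimit D c hc x
    obtain ⟨i, f, hf⟩ := eq (x := x ^ 2) (y := 0) (by rw [map_pow, hx, map_zero])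
    have := (h i).isReduced
    rw [map_pow, map_zero] at hf
    rw [← hw f, eq_zero_of_pow_eq_zero hf, map_zero]
  · obtain ⟨j, x, y, rfl, rfl⟩ := lift₂ x y
    obtain ⟨i, f, hf⟩ := eq (x := x ^ 3) (y := y ^ 2) (by rw [map_pow, map_pow, hxy])
    rw [map_pow, map_pow] at hf
    obtain ⟨a, h2, h3⟩ := (h i).exists_sq_cube _ _ hf
    exact ⟨(c.π.app i).appTop a, by rw [← map_pow, h2, hw], by rw [← map_pow, h3, hw]⟩
  · obtain ⟨j, x, y, rfl, rfl⟩ := lift₂ x y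
    obtain ⟨i, f, hf⟩ := eq (x := (p : Γ(D.obj j, ⊤)) ^ p * x) (y := y ^ p) (by
      rw [map_pow, map_mul, map_pow, map_natCast, hxy])
    rw [map_pow, map_mul, map_pow, map_natCast] at hf
    obtain ⟨a, h1, h2⟩ := (h i).exists_pow_mul p hp _ _ hf
    exact ⟨(c.π.app i).appTop a, by rw [← map_pow, h1, hw],
      by rw [← hw f y, ← h2, map_mul, map_natCast]⟩

lemma hasLimit_of_isAffine {J : Type u} [SmallCategory J] (D : J ⥤ Scheme.{u})
    [∀ j, IsAffine (D.obj j)] : HasLimit D := by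
  let η : D ⟶ (D ⋙ Scheme.Γ.rightOp) ⋙ Scheme.Spec := Functor.whiskerLeft D ΓSpec.adjunction.unit
  have (j : J) : IsIso (η.app j) := inferInstanceAs (IsIso (D.obj j).toSpecΓ)
  have : IsIso η := NatIso.isIso_of_isIso_app η
  exact hasLimit_of_iso (asIso η).symm

variable {X : Scheme.{u}} {J : Type u} [SmallCategory J] (K : J ⥤ Over X) (U : X.Opens)

/-- The restriction of a diagram over `X` to an open of `X`. -/
noncomputable def restrictDiagram : J ⥤ Scheme.{u} where
  obj j := ((K.obj j).hom ⁻¹ᵁ U).toScheme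
  map {i j} f := (K.map f).left.resLE _ _ (by
    rw [← Scheme.Hom.comp_preimage, Over.w])
  map_id j := by simp [← cancel_mono (Scheme.Opens.ι _)]
  map_comp f g := by simp [← cancel_mono (Scheme.Opens.ι _)]

/-- The inclusion of the restricted diagram. -/
noncomputable def restrictDiagramι (j : J) : (restrictDiagram K U).obj j ⟶ (K.obj j).left :=
  ((K.obj j).hom ⁻¹ᵁ U).ι

instance (j : J) : IsOpenImmersion (restrictDiagramι K U j) :=
  inferInstanceAs (IsOpenImmersion ((K.obj j).hom ⁻¹ᵁ U).ι)

lemma restrictDiagram_map_ι {i j : J} (f : i ⟶ j) :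
    (restrictDiagram K U).map f ≫ restrictDiagramι K U j =
      restrictDiagramι K U i ≫ (K.map f).left :=
  Scheme.Hom.resLE_comp_ι _ _

lemma range_restrictDiagramι_subset (j : J) :
    Set.range (restrictDiagramι K U j ≫ (K.obj j).hom) ⊆ U := by
  rintro _ ⟨x, rfl⟩
  exact x.2

variable {K} {U}

lemma exists_hom_to_base [IsCofiltered J] (c : Cone (restrictDiagram K U)) :
    ∃ s : c.pt ⟶ X, (∀ j, (c.π.app j ≫ restrictDiagramι K U j) ≫ (K.obj j).hom = s) ∧
      Set.range s ⊆ U := by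
  have key {i j : J} (f : i ⟶ j) : (c.π.app i ≫ restrictDiagramι K U i) ≫ (K.obj i).hom =
      (c.π.app j ≫ restrictDiagramι K U j) ≫ (K.obj j).hom := by
    rw [← c.w f, Category.assoc, Category.assoc, Category.assoc,
      reassoc_of% (restrictDiagram_map_ι K U f), Over.w]
  let j₀ : J := Classical.choice IsCofiltered.nonempty
  refine ⟨_, fun j => (key (IsCofiltered.minToRight j₀ j)).symm.trans
    (key (IsCofiltered.minToLeft j₀ j)), ?_⟩
  rintro _ ⟨x, rfl⟩
  rw [Category.assoc, Scheme.Hom.comp_apply]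
  exact range_restrictDiagramι_subset K U j₀ ⟨_, rfl⟩

/-- The object `T` is universal only for coherent test schemes. Two of them suffice: the affine
limit `lc.pt` and the part of `T` over `U`. -/
lemma nonempty_restrict_iso_limit [IsCofiltered J] [CompactSpace X] [QuasiSeparatedSpace X]
    (hU : IsAffineOpen U) (lc : Cone (restrictDiagram K U)) (hlc : IsLimit lc) [IsAffine lc.pt]
    (T : Over X) (hT : IsCoherent T.left) (q : ∀ j, T ⟶ K.obj j)
    (hq : ∀ {i j} (f : i ⟶ j), q i ≫ K.map f = q j)
    (hlift : ∀ (W : Over X) (r : ∀ j, W ⟶ K.obj j), IsCoherent W.left →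
      (∀ {i j} (f : i ⟶ j), r i ≫ K.map f = r j) → ∃ f : W ⟶ T, ∀ j, f ≫ q j = r j)
    (hext : ∀ (W : Over X) (f g : W ⟶ T), IsCoherent W.left →
      (∀ j, f ≫ q j = g ≫ q j) → f = g) :
    Nonempty ((T.hom ⁻¹ᵁ U).toScheme ≅ lc.pt) := by
  obtain ⟨s, hs, hsU⟩ := exists_hom_to_base (lc)
  obtain ⟨σ, hσ⟩ := hlift (Over.mk s)
    (fun j => Over.homMk (lc.π.app j ≫ restrictDiagramι K U j) (hs j))
    ⟨inferInstanceAs (CompactSpace ↥(lc.pt)), inferInstanceAs (QuasiSeparatedSpace ↥(lc.pt))⟩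
    (fun {i j} f => by
      ext1
      change (lc.π.app i ≫ restrictDiagramι K U i) ≫ (K.map f).left =
        lc.π.app j ≫ restrictDiagramι K U j
      rw [← lc.w f, Category.assoc, Category.assoc, restrictDiagram_map_ι])
  let σ₀ : lc.pt ⟶ T.left := σ.left
  have hσ₀ (j : J) : σ₀ ≫ (q j).left = lc.π.app j ≫ restrictDiagramι K U j :=
    congrArg CommaMorphism.left (hσ j)
  have hσT : σ₀ ≫ T.hom = s := Over.w σ
  let V : T.left.Opens := T.hom ⁻¹ᵁ U
  let σ' : lc.pt ⟶ V := IsOpenImmersion.lift V.ι σ₀ (by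
    rintro _ ⟨x, rfl⟩
    have : T.hom (σ₀ x) ∈ U := by
      rw [← Scheme.Hom.comp_apply, hσT]
      exact hsU ⟨x, rfl⟩
    rw [Scheme.Opens.range_ι]
    exact this)
  have hσ' : σ' ≫ V.ι = σ₀ := IsOpenImmersion.lift_fac _ _ _
  let p (j : J) : V.toScheme ⟶ (restrictDiagram K U).obj j := (q j).left.resLE _ _ (by
    rw [← Scheme.Hom.comp_preimage, Over.w])
  have hp (j : J) : p j ≫ restrictDiagramι K U j = V.ι ≫ (q j).left :=
    Scheme.Hom.resLE_comp_ι _ _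
  let τ : V.toScheme ⟶ lc.pt := hlc.lift
    { pt := V.toScheme
      π :=
        { app := p
          naturality i j f := by
            refine (Category.id_comp _).trans ?_
            rw [← cancel_mono (restrictDiagramι K U j), Category.assoc, restrictDiagram_map_ι, hp,
              reassoc_of% (hp i), ← hq f, Over.comp_left] } }
  have hτ (j : J) : τ ≫ lc.π.app j = p j := hlc.fac _ _
  refine ⟨⟨τ, σ', ?_, ?_⟩⟩
  -- Quasicompactness of `T.hom` makes the preimage of `U` coherent, so that `hext` applies to it.
  · have hqc : QuasiCompact T.hom := by
      have := hT.compactSpace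
      have : CompactSpace ((Functor.id Scheme.{u}).obj T.left) := hT.compactSpace
      infer_instance
    have hV : IsCoherent V.toScheme :=
      ⟨isCompact_iff_compactSpace.mp (T.hom.isCompact_preimage hU.isCompact),
        have := hT.quasiSeparatedSpace; quasiSeparatedSpace_of_quasiSeparated V.ι⟩
    have h0 : (τ ≫ σ₀) ≫ T.hom = V.ι ≫ T.hom := by
      let j : J := Classical.choice IsCofiltered.nonempty
      rw [← Over.w (q j), ← Category.assoc, ← Category.assoc V.ι, Category.assoc τ, hσ₀,
        ← Category.assoc τ, hτ, hp]
    have h1 : τ ≫ σ₀ = V.ι := by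
      have := hext (Over.mk (V.ι ≫ T.hom))
        (Over.homMk (τ ≫ σ₀) h0) (Over.homMk V.ι rfl) hV (fun j => by
          ext1
          change (τ ≫ σ₀) ≫ (q j).left = V.ι ≫ (q j).left
          rw [Category.assoc, hσ₀, ← Category.assoc, hτ, hp])
      exact congrArg CommaMorphism.left this
    rw [← cancel_mono V.ι, Category.assoc, hσ', h1, Category.id_comp]
  · refine hlc.hom_ext fun j => ?_
    rw [← cancel_mono (restrictDiagramι K U j), Category.assoc, Category.assoc, reassoc_of% (hτ j), hp,
      reassoc_of% hσ', hσ₀, Category.id_comp]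

lemma isTopologicallyRigid_of_coherent_limit [IsCofiltered J] [CompactSpace X]
    [QuasiSeparatedSpace X] (hK : ∀ j, IsTopologicallyRigid (K.obj j).left)
    [∀ j, IsAffineHom (K.obj j).hom]
    (T : Over X) (hT : IsCoherent T.left) (q : ∀ j, T ⟶ K.obj j)
    (hq : ∀ {i j} (f : i ⟶ j), q i ≫ K.map f = q j)
    (hlift : ∀ (W : Over X) (r : ∀ j, W ⟶ K.obj j), IsCoherent W.left →
      (∀ {i j} (f : i ⟶ j), r i ≫ K.map f = r j) → ∃ f : W ⟶ T, ∀ j, f ≫ q j = r j)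
    (hext : ∀ (W : Over X) (f g : W ⟶ T), IsCoherent W.left →
      (∀ j, f ≫ q j = g ≫ q j) → f = g) :
    IsTopologicallyRigid T.left := by
  have key (U : X.affineOpens) : IsAffine (T.hom ⁻¹ᵁ U.1) ∧ IsAbsWeaklyNormal Γ(T.hom ⁻¹ᵁ U.1, ⊤) := by
    have haff (j : J) : IsAffine ((restrictDiagram K U.1).obj j) := U.2.preimage (K.obj j).hom
    have := hasLimit_of_isAffine (restrictDiagram K U.1)
    have hl := limit.isLimit (restrictDiagram K U.1)
    have : IsAffine (limit.cone (restrictDiagram K U.1)).pt := Scheme.isAffine_of_isLimit _ hl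
    obtain ⟨e⟩ := nonempty_restrict_iso_limit U.2 _ hl T hT q hq hlift hext
    have hawn := isAbsWeaklyNormal_of_isLimit _ _ hl fun j =>
      ((hK j).isAbsWeaklyNormal (U.2.preimage (K.obj j).hom)).of_ringEquiv
        ((K.obj j).hom ⁻¹ᵁ U.1).topIso.symm.commRingCatIsoToRingEquiv
    exact ⟨.of_isIso e.hom,
      hawn.of_ringEquiv (Scheme.Γ.mapIso e.op).commRingCatIsoToRingEquiv⟩
  refine isTopologicallyRigid_of_isAbsWeaklyNormal hT (fun U : X.affineOpens => T.hom ⁻¹ᵁ U.1) ?_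
    (fun U => (key U).1) (fun U => (key U).2)
  rw [← Scheme.Hom.preimage_iSup, iSup_affineOpens_eq_top]
  rfl

end Limit

end TopRigid

theorem mainTheorem9 (X : Scheme.{u}) (hX : TopRigid.IsCoherent X)
    (Λ : Type u) [SmallCategory Λ] [IsFiltered Λ]
    (Z : Λᵒᵖ ⥤ TopRigid.SchTrig X)
    (hZ : ∀ α : Λᵒᵖ, IsAffineHom ((TopRigid.trigInclusion X).obj (Z.obj α)).obj.hom) :
    (∀ c : Cone (Z ⋙ TopRigid.trigInclusion X), IsLimit c →
      TopRigid.IsTopologicallyRigid c.pt.obj.left ∧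
      ∃ c' : Cone Z, Nonempty ((TopRigid.trigInclusion X).mapCone c' ≅ c) ∧
        Nonempty (IsLimit c')) ∧
    ReflectsLimit Z (TopRigid.trigInclusion X) := by
  -- A fully faithful functor reflects limits.
  refine ⟨fun c hc => ?_, inferInstance⟩
  have hrig : TopRigid.IsTopologicallyRigid c.pt.obj.left := by
    have := hX.compactSpace
    have := hX.quasiSeparatedSpace
    let K : Λᵒᵖ ⥤ Over X := Z ⋙ TopRigid.trigInclusion X ⋙ ObjectProperty.ι _
    have (j : Λᵒᵖ) : IsAffineHom (K.obj j).hom := hZ j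
    refine TopRigid.isTopologicallyRigid_of_coherent_limit (K := K) (fun j => (Z.obj j).property)
      c.pt.obj c.pt.property (fun j => (c.π.app j).hom) (fun f => ?_) (fun W r hW hr => ?_)
      (fun W f g hW h => ?_)
    · exact congrArg InducedCategory.Hom.hom (c.w f)
    · let s : Cone (Z ⋙ TopRigid.trigInclusion X) :=
        { pt := ⟨W, hW⟩
          π :=
            { app j := ObjectProperty.homMk (r j)
              naturality i j f := by
                refine (Category.id_comp _).trans ?_
                ext1
                exact (hr f).symm } }
      exact ⟨(hc.lift s).hom, fun j => congrArg InducedCategory.Hom.hom (hc.fac s j)⟩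
    · let W' : TopRigid.SchCoh X := ⟨W, hW⟩
      let f' : W' ⟶ c.pt := ObjectProperty.homMk f
      let g' : W' ⟶ c.pt := ObjectProperty.homMk g
      have : f' = g' := hc.hom_ext fun j => by
        ext1
        exact h j
      exact congrArg InducedCategory.Hom.hom this
  let c' : Cone Z :=
    { pt := ⟨c.pt, hrig⟩
      π :=
        { app j := ObjectProperty.homMk (c.π.app j)
          naturality i j f := by
            ext1
            exact c.π.naturality f } }
  have e : (TopRigid.trigInclusion X).mapCone c' ≅ c := Cone.ext (Iso.refl _) fun j => by
    refine Eq.trans ?_ (Category.id_comp _).symm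
    rfl
  exact ⟨hrig, c', ⟨e⟩, ⟨isLimitOfReflects (TopRigid.trigInclusion X) (hc.ofIsoLimit e.symm)⟩⟩
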